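/- Let $\mathcal G$ be an undirected connected graph on $N\ge 2$ vertices with positive edge weights, adjacency matrix $(a_{ij})$ (symmetric, with zero diagonal; $a_{ij}>0$ is the weight of the edge $\{i,j\}$, and $a_{ij}=0$ if there is no such edge) and Laplacian $L=\mathrm{diag}(\sum_j a_{1j},\dots,\sum_j a_{Nj})-(a_{ij})$, and let $0=\lambda_1\le\lambda_2\le\dots\le\lambda_N$ be the eigenvalues of $L$, listed with multiplicity. For every edge $\{i,j\}$ let $\Delta_{ij}=\Delta_{ji}:L^2[0,\infty)\to L^2[0,\infty)$ be a causal linear operator on real signals of gain at most $\delta$, that is, $\|\Delta_{ij}f\|_2\le\delta\|f\|_2+b_{ij}$ for all $f$, with a constant $b_{ij}$; it acts on signals that are only locally square integrable through truncation to the intervals $[0,\tau]$. Let $\alpha,\beta,\mu,\nu>0$. Consider the integrator network $$\dot x_i=u_i,\qquad u_i=-\beta\sum_{j=1}^N a_{ij}(\hat x_i-\hat x_j)-\beta\sum_{j=1}^N a_{ij}\,\Delta_{ij}(\hat x_i-\hat x_j),\qquad i=1,\dots,N,$$ where $\hat x_i(t)=x_i(t^i_k)$ for $t\in[t^i_k,t^i_{k+1})$,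 and the triggering instants of agent $i$ are $t^i_0=0$ and $t^i_{k+1}=\inf\{t>t^i_k: f_i(t)\ge 0\}$ (with $t^i_{k+1}=\infty$ if there is no further event), where $$f_i=(\hat x_i-x_i)^2-\alpha\sum_{j=1}^N a_{ij}(\hat x_i-\hat x_j)^2-\mu e^{-\nu t}$$ and $\hat x_i$ in $f_i$ is the estimate that has not yet been updated (when several agents trigger at the same instant, their updates may be processed in any order). Let $\gamma=\max\{\delta,\sqrt{2\alpha\lambda_N}\}$. If $$\gamma<\sqrt{\frac{\lambda_2^2}{\lambda_2^2+\lambda_N^2}},$$ then every trajectory of the closed loop, followed from time $0$ up to the first time at which the triggering instants of some agent accumulate, exists for all $t\ge 0$ and reaches consensus: $x_i(t)-x_j(t)\to 0$ as $t\to\infty$ for all $i,j$. Moreover, there is no Zeno behavior: every agent has only finitely many triggering instants in every bounded time interval. -/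

import Mathlib

open MeasureTheory Filter Topology Set

noncomputable section

namespace EventTriggered

/-! ### Weighted undirected graphs and their Laplacian spectrum -/

/-- An undirected graph on `N` vertices with positive edge weights, given by its adjacency matrix:
`a i j > 0` is the weight of the edge `{i, j}`, and `a i j = 0` if there is no such edge. -/
structure WeightedGraph (N : ℕ) where
  a : Matrix (Fin N) (Fin N) ℝ
  symm : a.IsSymm
  nonneg : ∀ i j, 0 ≤ a i j
  no_loops : ∀ i, a i i = 0

namespace WeightedGraph

variable {N : ℕ} (G : WeightedGraph N)

/-- The underlying simple graph. -/
def toSimpleGraph : SimpleGraph (Fin N) := SimpleGraph.fromRel (fun i j => 0 < G.a i j)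

/-- The Laplacian `diag (d_1, …, d_N) - a`, with the weighted degrees `d_i = ∑ j, a i j`. -/
def laplacian : Matrix (Fin N) (Fin N) ℝ :=
  Matrix.diagonal (fun i => ∑ j, G.a i j) - G.a

theorem laplacian_isHermitian : G.laplacian.IsHermitian := by
  unfold laplacian
  refine (Matrix.isHermitian_diagonal _).sub ?_
  ext i j
  simpa using congrFun (congrFun G.symm i) j

/-- The eigenvalues of the Laplacian with multiplicity, in increasing order:
`G.eig ⟨0, _⟩ ≤ G.eig ⟨1, _⟩ ≤ … ≤ G.eig ⟨N - 1, _⟩`. -/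
def eig (k : Fin N) : ℝ :=
  G.laplacian_isHermitian.eigenvalues₀ (Fin.cast (Fintype.card_fin N).symm k.rev)

/-- The second smallest eigenvalue of the Laplacian (with multiplicity). -/
def lambdaTwo (hN : 2 ≤ N) : ℝ := G.eig ⟨1, by omega⟩

/-- The largest eigenvalue of the Laplacian. -/
def lambdaMax (hN : 2 ≤ N) : ℝ := G.eig ⟨N - 1, by omega⟩

end WeightedGraph

/-! ### Operators on the signal space `L²[0, ∞)` -/

/-- Real square integrable signals on `[0, ∞)`. -/
abbrev L2Signal : Type := Lp ℝ 2 (volume.restrict (Ici (0 : ℝ)))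

/-- The operator has finite gain at most `δ`: `‖Δ f‖ ≤ δ ‖f‖ + b` for some constant `b`. -/
def GainAtMost (Δ : L2Signal →ₗ[ℝ] L2Signal) (δ : ℝ) : Prop :=
  ∃ b : ℝ, ∀ f : L2Signal, ‖Δ f‖ ≤ δ * ‖f‖ + b

/-- The output on `[0, τ]` is determined by the input on `[0, τ]`. -/
def Causal (Δ : L2Signal →ₗ[ℝ] L2Signal) : Prop :=
  ∀ (τ : ℝ) (f g : L2Signal), f =ᵐ[volume.restrict (Icc 0 τ)] g →
    Δ f =ᵐ[volume.restrict (Icc 0 τ)] Δ g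

open Classical in
/-- The truncation to `[0, τ]` of a signal `u` that is square integrable on `[0, τ]`, as an element
of `L²[0, ∞)`. -/
def trunc (τ : ℝ) (u : ℝ → ℝ) : L2Signal :=
  if h : MemLp ((Icc 0 τ).indicator u) 2 (volume.restrict (Ici (0 : ℝ))) then h.toLp else 0

/-- `v = Δ u` on `[0, T)`, for a causal operator and a signal `u` that is square integrable on
compact subintervals of `[0, T)` (but not necessarily on all of `[0, T)`): on each `[0, τ]` the
output is that of the truncated input. -/
def IsOutput (Δ : L2Signal →ₗ[ℝ] L2Signal) (T : EReal) (u v : ℝ → ℝ) : Prop :=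
  ∀ τ : ℝ, (τ : EReal) < T → v =ᵐ[volume.restrict (Icc 0 τ)] Δ (trunc τ u)

/-! ### The event-triggered closed loop -/

/-- `t i k` is the `k`-th triggering instant of agent `i`, with value `⊤` if agent `i` triggers
fewer than `k + 1` times. Agent `i` keeps a defined estimate up to the time `⨆ k, t i k`, so that the
closed loop lives on `[0, horizon t)`. The horizon is finite exactly if some agent triggers
infinitely often in finite time. -/
def horizon {N : ℕ} (t : Fin N → ℕ → EReal) : EReal := ⨅ i, ⨆ k, t i k

/-- A trajectory of the integrator network `x_i' = u_i` with the event-triggered control law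
`u_i = -β ∑ j, a_ij (1 + Δ_ij) (xhat_i - xhat_j)` and the triggering function
`f_i = (xhat_i - x_i)² - α ∑ j, a_ij (xhat_i - xhat_j)² - μ exp (-ν t)`.
It starts at time `0` and is followed up to `horizon t`. -/
structure Trajectory {N : ℕ} (G : WeightedGraph N)
    (Δ : Fin N → Fin N → L2Signal →ₗ[ℝ] L2Signal) (α β μ ν : ℝ) where
  /-- the states -/
  x : Fin N → ℝ → ℝ
  /-- the estimates of the states that are held between the triggering instants -/
  xhat : Fin N → ℝ → ℝ
  /-- the outputs of the uncertainties on the edges -/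
  v : Fin N → Fin N → ℝ → ℝ
  /-- the triggering instants -/
  t : Fin N → ℕ → EReal
  t_zero : ∀ i, t i 0 = 0
  t_lt_succ : ∀ i k, t i k ≠ ⊤ → t i k < t i (k + 1)
  t_top : ∀ i k, t i k = ⊤ → t i (k + 1) = ⊤
  /-- zero-order hold: `xhat_i = x_i(t_k)` on `[t_k, t_{k+1})` -/
  hold : ∀ i k (s : ℝ), t i k ≤ s → (s : EReal) < t i (k + 1) → (s : EReal) < horizon t →
    xhat i s = x i (t i k).toReal
  /-- `v_ij = Δ_ij (xhat_i - xhat_j)` along the edges -/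
  output : ∀ i j, 0 < G.a i j →
    IsOutput (Δ i j) (horizon t) (fun s => xhat i s - xhat j s) (v i j)
  /-- `x_i' = -β ∑ j, a_ij (xhat_i - xhat_j) - β ∑ j, a_ij v_ij`, in integrated form -/
  dynamics : ∀ i (τ : ℝ), 0 ≤ τ → (τ : EReal) < horizon t →
    x i τ = x i 0 + ∫ s in (0 : ℝ)..τ,
      (-β * ∑ j, G.a i j * (xhat i s - xhat j s) - β * ∑ j, G.a i j * v i j s)
  /-- `f_i < 0` strictly between two consecutive triggering instants: no event is missed -/
  no_event : ∀ i k (s : ℝ), t i k < s → (s : EReal) < t i (k + 1) → (s : EReal) < horizon t →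
    (xhat i s - x i s) ^ 2 - α * ∑ j, G.a i j * (xhat i s - xhat j s) ^ 2
      - μ * Real.exp (-ν * s) < 0
  /-- `f_i ≥ 0` at the next triggering instant `s` of agent `i`, with the estimate of agent `i` not
  yet updated. If other agents also trigger at the instant `s`, any order of the updates is
  admitted: the estimate of agent `j` in `f_i` is the one held immediately before `s` or the one
  held from `s` on (both are `x_j(t_m)` for some `m` with `t_m ≤ s ≤ t_{m+1}`). -/
  event : ∀ i k (s : ℝ), t i (k + 1) = s → (s : EReal) < horizon t →
    ∃ m : Fin N → ℕ, (∀ j, t j (m j) ≤ s ∧ (s : EReal) ≤ t j (m j + 1)) ∧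
      0 ≤ (x i (t i k).toReal - x i s) ^ 2
        - α * ∑ j, G.a i j * (x i (t i k).toReal - x j (t j (m j)).toReal) ^ 2
        - μ * Real.exp (-ν * s)

end EventTriggered

end

/-! The proof is an energy argument with storage function `|x|²`. On an edge write `z` for the
difference of the estimates, `p` for the difference of the states, `e = z - p` for the difference of
the measurement errors and `v` for the output of the uncertainty. Since `Δ i j = Δ j i` is linear,
`v` is antisymmetric like `z`, and summation by parts turns the derivative of `|x|²` into a sum of
`-β p (z + v)` over ordered pairs. The identity `e² + v² - z² + 2p(z + v) = (p + v)²` bounds this by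
`β/2` times the weighted sum of `e² + v² - z²` (`dissipation`).

The triggering rule gives `|e|² ≤ γ²|z|²` up to an exponentially decaying term, because `2αλ_N ≤
γ²`. The gain bound gives `∫|v|² ≤ γ²∫|z|²` on every `[0, τ]`; linearity removes its offset.
Integration therefore bounds `(1 - 2γ²)∫|z|²` uniformly in `τ` (`integral_disagreement_le`). As `λ₂
≤ λ_N`, the spectral hypothesis implies `2γ² < 1`, so `z` has finite energy up to the horizon.

Hence the inputs have finite energy. Between two events of an agent its state moves by a definite
amount, so Cauchy–Schwarz bounds the time between events from below and the horizon is infinite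
(`horizon_eq_top`). Along each edge `x_i - x_j` and its derivative are then square integrable on
`[0, ∞)`, so the difference tends to zero (`tendsto_zero_of_integral_sq_le`); connectedness extends
this to all pairs. -/

theorem Matrix.IsHermitian.dotProduct_mulVec_le {n : Type*} [Fintype n] [DecidableEq n]
    {A : Matrix n n ℝ} (hA : A.IsHermitian) {c : ℝ} (h : ∀ i, hA.eigenvalues i ≤ c) (x : n → ℝ) :
    x ⬝ᵥ A.mulVec x ≤ c * (x ⬝ᵥ x) := by
  -- In an orthonormal eigenbasis this matrix is diagonal with entries `c - λ_i ≥ 0`.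
  have hpsd : (c • (1 : Matrix n n ℝ) - A).PosSemidef := by
    have hd : (Matrix.diagonal (fun i => c - hA.eigenvalues i)).PosSemidef :=
      Matrix.PosSemidef.diagonal fun i => sub_nonneg.2 (h i)
    have hU := hd.mul_mul_conjTranspose_same (hA.eigenvectorUnitary : Matrix n n ℝ)
    convert hU using 1
    have hA' := hA.spectral_theorem
    rw [Unitary.conjStarAlgAut_apply] at hA'
    have h1 : (hA.eigenvectorUnitary : Matrix n n ℝ) *
        star (hA.eigenvectorUnitary : Matrix n n ℝ) = 1 := Unitary.coe_mul_star_self _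
    have h2 : Matrix.diagonal (fun i => c - hA.eigenvalues i) =
        c • (1 : Matrix n n ℝ) - Matrix.diagonal (RCLike.ofReal ∘ hA.eigenvalues) := by
      ext i j
      by_cases hij : i = j
      · subst hij; simp
      · simp [hij]
    rw [h2, ← Matrix.star_eq_conjTranspose, mul_sub, sub_mul, ← hA']
    simp [h1]
  have := hpsd.dotProduct_mulVec_nonneg x
  simp only [star_trivial, Matrix.sub_mulVec, Matrix.smul_mulVec, Matrix.one_mulVec,
    dotProduct_sub, dotProduct_smul, smul_eq_mul] at this
  linarith

/-! ### Laplacian quadratic form and pointwise estimates on the edges -/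

namespace EventTriggered
namespace WeightedGraph

variable {N : ℕ} (G : WeightedGraph N)

theorem a_comm (i j : Fin N) : G.a i j = G.a j i := G.symm.apply j i

theorem two_mul_dotProduct_laplacian (x : Fin N → ℝ) :
    2 * (x ⬝ᵥ G.laplacian.mulVec x) = ∑ i, ∑ j, G.a i j * (x i - x j) ^ 2 := by
  have h1 : x ⬝ᵥ G.laplacian.mulVec x =
      ∑ i, ∑ j, G.a i j * x i ^ 2 - ∑ i, ∑ j, G.a i j * (x i * x j) := by
    rw [laplacian, Matrix.sub_mulVec, dotProduct_sub]
    congr 1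
    · simp only [dotProduct, Matrix.mulVec_diagonal]
      refine Finset.sum_congr rfl fun i _ => ?_
      rw [Finset.sum_mul, Finset.mul_sum]
      exact Finset.sum_congr rfl fun j _ => by ring
    · simp only [dotProduct, Matrix.mulVec, Finset.mul_sum]
      exact Finset.sum_congr rfl fun i _ => Finset.sum_congr rfl fun j _ => by ring
  have h2 : ∑ i, ∑ j, G.a i j * x j ^ 2 = ∑ i, ∑ j, G.a i j * x i ^ 2 := by
    rw [Finset.sum_comm]
    exact Finset.sum_congr rfl fun i _ => Finset.sum_congr rfl fun j _ => by rw [G.a_comm]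
  have h3 : ∑ i, ∑ j, G.a i j * (x i - x j) ^ 2 = ∑ i, ∑ j, G.a i j * x i ^ 2 +
      ∑ i, ∑ j, G.a i j * x j ^ 2 - 2 * ∑ i, ∑ j, G.a i j * (x i * x j) := by
    simp only [Finset.mul_sum, ← Finset.sum_add_distrib, ← Finset.sum_sub_distrib]
    exact Finset.sum_congr rfl fun i _ => Finset.sum_congr rfl fun j _ => by ring
  rw [h3, h1, h2]
  ring

theorem laplacian_posSemidef : G.laplacian.PosSemidef := by
  refine Matrix.PosSemidef.of_dotProduct_mulVec_nonneg G.laplacian_isHermitian fun x => ?_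
  have h := G.two_mul_dotProduct_laplacian x
  have : 0 ≤ ∑ i, ∑ j, G.a i j * (x i - x j) ^ 2 :=
    Finset.sum_nonneg fun i _ => Finset.sum_nonneg fun j _ =>
      mul_nonneg (G.nonneg i j) (sq_nonneg _)
  rw [star_trivial]
  linarith

theorem eig_nonneg (k : Fin N) : 0 ≤ G.eig k := by
  have h := G.laplacian_posSemidef.eigenvalues_nonneg
    (Fintype.equivOfCardEq (Fintype.card_fin _) (Fin.cast (Fintype.card_fin N).symm k.rev))
  rwa [Matrix.IsHermitian.eigenvalues, Equiv.symm_apply_apply] at h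

theorem eig_mono : Monotone G.eig := fun k l hkl =>
  G.laplacian_isHermitian.eigenvalues₀_antitone (by
    rw [Fin.le_def]; simp only [Fin.val_cast, Fin.val_rev]
    have := Fin.le_def.1 hkl
    omega)

theorem lambdaTwo_nonneg (hN : 2 ≤ N) : 0 ≤ G.lambdaTwo hN := G.eig_nonneg _

theorem lambdaTwo_le_lambdaMax (hN : 2 ≤ N) : G.lambdaTwo hN ≤ G.lambdaMax hN :=
  G.eig_mono (by rw [Fin.le_def]; simp only; omega)

theorem eigenvalues_le_lambdaMax (hN : 2 ≤ N) (i : Fin N) :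
    G.laplacian_isHermitian.eigenvalues i ≤ G.lambdaMax hN := by
  rw [Matrix.IsHermitian.eigenvalues, lambdaMax, eig]
  refine G.laplacian_isHermitian.eigenvalues₀_antitone ?_
  rw [Fin.le_def]; simp only [Fin.val_cast, Fin.val_rev]
  omega

/-- The quadratic form of the Laplacian is at most `λ_N |x|²`. -/
theorem sum_edges_sq_sub_le (hN : 2 ≤ N) (x : Fin N → ℝ) :
    ∑ i, ∑ j, G.a i j * (x i - x j) ^ 2 ≤ 2 * G.lambdaMax hN * ∑ i, x i ^ 2 := by
  have h := G.laplacian_isHermitian.dotProduct_mulVec_le (G.eigenvalues_le_lambdaMax hN) x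
  rw [← G.two_mul_dotProduct_laplacian]
  have h2 : x ⬝ᵥ x = ∑ i, x i ^ 2 := by
    simp only [dotProduct, pow_two]
  rw [h2] at h
  linarith

/-- Summation by parts over the edges. -/
theorem sum_mul_sum_antisymm (x : Fin N → ℝ) (w : Fin N → Fin N → ℝ)
    (hw : ∀ i j, 0 < G.a i j → w j i = -w i j) :
    2 * ∑ i, x i * ∑ j, G.a i j * w i j = ∑ i, ∑ j, G.a i j * ((x i - x j) * w i j) := by
  -- Exchanging the two indices flips the sign of `w`; off the edges, where `w` is arbitrary, the
  -- weight vanishes.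
  have h1 : ∑ i, ∑ j, G.a i j * (x j * w i j) = -∑ i, ∑ j, G.a i j * (x i * w i j) := by
    rw [Finset.sum_comm, ← Finset.sum_neg_distrib]
    refine Finset.sum_congr rfl fun i _ => ?_
    rw [← Finset.sum_neg_distrib]
    refine Finset.sum_congr rfl fun j _ => ?_
    rcases (G.nonneg i j).eq_or_lt with h | h
    · rw [G.a_comm j i, ← h]; ring
    · rw [G.a_comm j i, hw i j h]; ring
  have h2 : ∑ i, x i * ∑ j, G.a i j * w i j = ∑ i, ∑ j, G.a i j * (x i * w i j) := by
    refine Finset.sum_congr rfl fun i _ => ?_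
    rw [Finset.mul_sum]
    exact Finset.sum_congr rfl fun j _ => by ring
  have h3 : ∑ i, ∑ j, G.a i j * ((x i - x j) * w i j) =
      ∑ i, ∑ j, G.a i j * (x i * w i j) - ∑ i, ∑ j, G.a i j * (x j * w i j) := by
    simp only [← Finset.sum_sub_distrib]
    exact Finset.sum_congr rfl fun i _ => Finset.sum_congr rfl fun j _ => by ring
  rw [h3, h1, h2]; ring

/-- The disagreement of the measurement errors is controlled by the triggering condition. -/
theorem sum_edges_error_le (hN : 2 ≤ N) {α γ m : ℝ} (hγ : 2 * α * G.lambdaMax hN ≤ γ ^ 2)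
    (x h : Fin N → ℝ)
    (htrig : ∀ i, (h i - x i) ^ 2 ≤ α * ∑ j, G.a i j * (h i - h j) ^ 2 + m) :
    ∑ i, ∑ j, G.a i j * ((h i - x i) - (h j - x j)) ^ 2 ≤
      γ ^ 2 * ∑ i, ∑ j, G.a i j * (h i - h j) ^ 2 + 2 * G.lambdaMax hN * N * m := by
  have hl : 0 ≤ G.lambdaMax hN := (G.lambdaTwo_nonneg hN).trans (G.lambdaTwo_le_lambdaMax hN)
  have h1 := G.sum_edges_sq_sub_le hN (fun i => h i - x i)
  have h2 : ∑ i, (h i - x i) ^ 2 ≤ α * ∑ i, ∑ j, G.a i j * (h i - h j) ^ 2 + N * m := by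
    refine (Finset.sum_le_sum fun i _ => htrig i).trans_eq ?_
    rw [Finset.sum_add_distrib, Finset.mul_sum]
    simp
  have h3 : 0 ≤ ∑ i, ∑ j, G.a i j * (h i - h j) ^ 2 :=
    Finset.sum_nonneg fun i _ => Finset.sum_nonneg fun j _ =>
      mul_nonneg (G.nonneg i j) (sq_nonneg _)
  -- The factor `2λ_N` meets `α` from the trigger; this product is what `γ ≥ √(2αλ_N)` controls.
  have h4 := mul_le_mul_of_nonneg_left h2 (mul_nonneg zero_le_two hl)
  have h5 := mul_le_mul_of_nonneg_right hγ h3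
  nlinarith

/-- The squared norm of the state is a storage function for the supply rate
`|p|² + |v|² - |z|²` on the edges. -/
theorem dissipation (hN : 2 ≤ N) {α β γ m : ℝ} (hβ : 0 ≤ β)
    (hγ : 2 * α * G.lambdaMax hN ≤ γ ^ 2) (x h : Fin N → ℝ) (v : Fin N → Fin N → ℝ)
    (hv : ∀ i j, 0 < G.a i j → v j i = -v i j)
    (htrig : ∀ i, (h i - x i) ^ 2 ≤ α * ∑ j, G.a i j * (h i - h j) ^ 2 + m) :
    2 * ∑ i, x i * (-β * ∑ j, G.a i j * (h i - h j) - β * ∑ j, G.a i j * v i j) ≤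
      β / 2 * ((γ ^ 2 - 1) * ∑ i, ∑ j, G.a i j * (h i - h j) ^ 2 +
        ∑ i, ∑ j, G.a i j * v i j ^ 2 + 2 * G.lambdaMax hN * N * m) := by
  have h1 := G.sum_edges_error_le hN hγ x h htrig
  have h2 := G.sum_mul_sum_antisymm x (fun i j => (h i - h j) + v i j) fun i j hij => by
    rw [hv i j hij]; ring
  have h3 : ∑ i, x i * (-β * ∑ j, G.a i j * (h i - h j) - β * ∑ j, G.a i j * v i j) =
      -β * ∑ i, x i * ∑ j, G.a i j * ((h i - h j) + v i j) := by
    rw [Finset.mul_sum]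
    refine Finset.sum_congr rfl fun i _ => ?_
    simp only [mul_add, Finset.sum_add_distrib]
    ring
  have h4 : -2 * ∑ i, ∑ j, G.a i j * ((x i - x j) * ((h i - h j) + v i j)) ≤
      ∑ i, ∑ j, G.a i j * ((h i - x i) - (h j - x j)) ^ 2 +
        ∑ i, ∑ j, G.a i j * v i j ^ 2 - ∑ i, ∑ j, G.a i j * (h i - h j) ^ 2 := by
    simp only [Finset.mul_sum, ← Finset.sum_add_distrib, ← Finset.sum_sub_distrib]
    refine Finset.sum_le_sum fun i _ => Finset.sum_le_sum fun j _ => ?_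
    -- The right side minus the left side is exactly this weighted square.
    nlinarith [mul_nonneg (G.nonneg i j) (sq_nonneg ((x i - x j) + v i j))]
  rw [h3]
  nlinarith [mul_le_mul_of_nonneg_left (h4.trans (sub_le_sub_right (add_le_add_left h1 _) _)) hβ]

/-- Cauchy–Schwarz with weights `a i j` at node `i`, followed by enlarging the sum at one node to
the sum over all nodes. It transfers finite energy from the edges to the inputs. -/
theorem sq_input_le {β : ℝ} (h : Fin N → ℝ) (v : Fin N → Fin N → ℝ) (i : Fin N) :
    (-β * ∑ j, G.a i j * (h i - h j) - β * ∑ j, G.a i j * v i j) ^ 2 ≤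
      2 * β ^ 2 * (∑ j, G.a i j) * (∑ k, ∑ j, G.a k j * (h k - h j) ^ 2 +
        ∑ k, ∑ j, G.a k j * v k j ^ 2) := by
  have h1 : (-β * ∑ j, G.a i j * (h i - h j) - β * ∑ j, G.a i j * v i j) ^ 2 =
      β ^ 2 * (∑ j, G.a i j * ((h i - h j) + v i j)) ^ 2 := by
    simp only [mul_add, Finset.sum_add_distrib]
    ring
  have h2 : (∑ j, G.a i j * ((h i - h j) + v i j)) ^ 2 ≤
      (∑ j, G.a i j) * ∑ j, G.a i j * ((h i - h j) + v i j) ^ 2 :=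
    Finset.sum_sq_le_sum_mul_sum_of_sq_le_mul _ (fun j _ => G.nonneg i j)
      (fun j _ => mul_nonneg (G.nonneg i j) (sq_nonneg _)) fun j _ => le_of_eq (by ring)
  have hD : 0 ≤ ∑ j, G.a i j := Finset.sum_nonneg fun j _ => G.nonneg i j
  have h3 : ∑ j, G.a i j * ((h i - h j) + v i j) ^ 2 ≤
      ∑ k, ∑ j, G.a k j * ((h k - h j) + v k j) ^ 2 :=
    Finset.single_le_sum (f := fun k => ∑ j, G.a k j * ((h k - h j) + v k j) ^ 2)
      (fun k _ => Finset.sum_nonneg fun j _ => mul_nonneg (G.nonneg k j) (sq_nonneg _))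
      (Finset.mem_univ i)
  have h4 : ∑ k, ∑ j, G.a k j * ((h k - h j) + v k j) ^ 2 ≤
      2 * (∑ k, ∑ j, G.a k j * (h k - h j) ^ 2 + ∑ k, ∑ j, G.a k j * v k j ^ 2) := by
    simp only [Finset.mul_sum, ← Finset.sum_add_distrib]
    refine Finset.sum_le_sum fun k _ => Finset.sum_le_sum fun j _ => ?_
    nlinarith [mul_nonneg (G.nonneg k j) (sq_nonneg ((h k - h j) - v k j))]
  rw [h1]
  have h5 := mul_le_mul_of_nonneg_left
    (h2.trans (mul_le_mul_of_nonneg_left (h3.trans h4) hD)) (sq_nonneg β)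
  refine h5.trans_eq ?_
  ring

/-- A state difference is the difference of the estimates minus that of the errors, and the trigger
controls the latter. This carries energy bounds from the held estimates back to the states. -/
theorem sq_sub_le_of_edge (hN : 2 ≤ N) {α γ m : ℝ} (hγ : 2 * α * G.lambdaMax hN ≤ γ ^ 2)
    (x h : Fin N → ℝ)
    (htrig : ∀ i, (h i - x i) ^ 2 ≤ α * ∑ j, G.a i j * (h i - h j) ^ 2 + m) (i j : Fin N) :
    G.a i j * (x i - x j) ^ 2 ≤ 2 * ((1 + γ ^ 2) * ∑ i, ∑ j, G.a i j * (h i - h j) ^ 2 +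
      2 * G.lambdaMax hN * N * m) := by
  have h1 := G.sum_edges_error_le hN hγ x h htrig
  have h2 : G.a i j * (x i - x j) ^ 2 ≤ ∑ i, ∑ j, G.a i j * (x i - x j) ^ 2 :=
    (Finset.single_le_sum (f := fun j => G.a i j * (x i - x j) ^ 2)
      (fun j _ => mul_nonneg (G.nonneg i j) (sq_nonneg _)) (Finset.mem_univ j)).trans
    (Finset.single_le_sum (f := fun i => ∑ j, G.a i j * (x i - x j) ^ 2)
      (fun k _ => Finset.sum_nonneg fun j _ => mul_nonneg (G.nonneg k j) (sq_nonneg _))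
      (Finset.mem_univ i))
  have h3 : ∑ i, ∑ j, G.a i j * (x i - x j) ^ 2 ≤
      2 * (∑ i, ∑ j, G.a i j * (h i - h j) ^ 2 +
        ∑ i, ∑ j, G.a i j * ((h i - x i) - (h j - x j)) ^ 2) := by
    simp only [Finset.mul_sum, ← Finset.sum_add_distrib]
    refine Finset.sum_le_sum fun k _ => Finset.sum_le_sum fun l _ => ?_
    nlinarith [mul_nonneg (G.nonneg k l)
      (sq_nonneg ((h k - h l) + ((h k - x k) - (h l - x l))))]
  linarith

end WeightedGraph

/-! ### Square integrable functions on compact intervals and their primitives -/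

section Analysis

theorem intervalIntegrable_of_memLp {f : ℝ → ℝ} {T : ℝ} (hT : 0 ≤ T)
    (hf : MemLp f 2 (volume.restrict (Icc 0 T))) : IntervalIntegrable f volume 0 T :=
  (intervalIntegrable_iff_integrableOn_Icc_of_le hT).2 (hf.integrable (by norm_num))

theorem intervalIntegrable_mul_of_memLp {f g : ℝ → ℝ} {T : ℝ} (hT : 0 ≤ T)
    (hf : MemLp f 2 (volume.restrict (Icc 0 T))) (hg : MemLp g 2 (volume.restrict (Icc 0 T))) :
    IntervalIntegrable (fun s => f s * g s) volume 0 T :=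
  (intervalIntegrable_iff_integrableOn_Icc_of_le hT).2 (hf.integrable_mul hg)

theorem intervalIntegrable_sq_of_memLp {f : ℝ → ℝ} {T : ℝ} (hT : 0 ≤ T)
    (hf : MemLp f 2 (volume.restrict (Icc 0 T))) :
    IntervalIntegrable (fun s => f s ^ 2) volume 0 T := by
  simpa only [pow_two] using intervalIntegrable_mul_of_memLp hT hf hf

theorem memLp_two_of_continuousOn {f : ℝ → ℝ} {T : ℝ} (hf : ContinuousOn f (Icc 0 T)) :
    MemLp f 2 (volume.restrict (Icc 0 T)) := by
  obtain ⟨C, hC⟩ := isCompact_Icc.exists_bound_of_continuousOn hf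
  exact MemLp.of_bound (hf.aestronglyMeasurable measurableSet_Icc) C
    ((ae_restrict_iff' measurableSet_Icc).2 (Eventually.of_forall hC))

theorem continuousOn_of_eq_integral {X u : ℝ → ℝ} {T : ℝ} (hT : 0 ≤ T)
    (hu : IntervalIntegrable u volume 0 T)
    (hX : ∀ τ ∈ Icc 0 T, X τ = X 0 + ∫ s in (0 : ℝ)..τ, u s) : ContinuousOn X (Icc 0 T) := by
  have h := intervalIntegral.continuousOn_primitive_interval' hu left_mem_uIcc
  rw [uIcc_of_le hT] at h
  exact (h.const_add (X 0)).congr hX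

/-- The square of a primitive is the primitive of `2 X X'`. -/
theorem sq_eq_of_eq_integral {X u : ℝ → ℝ} {T : ℝ} (hT : 0 ≤ T)
    (hu : IntervalIntegrable u volume 0 T)
    (hX : ∀ τ ∈ Icc 0 T, X τ = X 0 + ∫ s in (0 : ℝ)..τ, u s) :
    X T ^ 2 = X 0 ^ 2 + ∫ s in (0 : ℝ)..T, 2 * (X s * u s) := by
  have hF : AbsolutelyContinuousOnInterval (fun τ => X 0 + ∫ s in (0 : ℝ)..τ, u s) 0 T :=
    (LipschitzOnWith.absolutelyContinuousOnInterval
      (LipschitzWith.const (X 0) (α := ℝ)).lipschitzOnWith).add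
      (hu.absolutelyContinuousOnInterval_intervalIntegral left_mem_uIcc)
  -- Integration by parts of an absolutely continuous function against itself; its derivative is `u`
  -- only almost everywhere.
  have h := hF.integral_deriv_mul_eq_sub hF
  simp only [intervalIntegral.integral_same, add_zero] at h
  rw [← hX T ⟨hT, le_rfl⟩] at h
  have h2 : ∫ s in (0 : ℝ)..T, 2 * (X s * u s) = X T * X T - X 0 * X 0 := by
    rw [← h]
    refine intervalIntegral.integral_congr_ae ?_
    filter_upwards [hu.ae_hasDerivAt_integral] with s hs hsT
    have hsT' : s ∈ Icc 0 T := by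
      rw [← uIcc_of_le hT]; exact uIoc_subset_uIcc hsT
    rw [((hs (uIoc_subset_uIcc hsT) 0 left_mem_uIcc).const_add (X 0)).deriv, ← hX s hsT']
    ring
  rw [h2]; ring

theorem integrableOn_Ioi_of_integral_norm_le {f : ℝ → ℝ} {C : ℝ}
    (hf : ∀ T, 0 ≤ T → IntervalIntegrable f volume 0 T)
    (hC : ∀ T, 0 ≤ T → ∫ s in (0 : ℝ)..T, ‖f s‖ ≤ C) : IntegrableOn f (Ioi 0) := by
  refine integrableOn_Ioi_of_intervalIntegral_norm_bounded (l := atTop) (b := fun T => T) C 0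
    (fun T => ?_) tendsto_id ?_
  · rcases le_total 0 T with h | h
    · exact (intervalIntegrable_iff_integrableOn_Ioc_of_le h).1 (hf T h)
    · simp [Ioc_eq_empty_of_le h]
  · filter_upwards [eventually_ge_atTop 0] with T hT using hC T hT

/-- A square integrable function with square integrable derivative tends to zero. -/
theorem tendsto_zero_of_integral_sq_le {d g : ℝ → ℝ} {C : ℝ}
    (hg : ∀ T, 0 ≤ T → MemLp g 2 (volume.restrict (Icc 0 T)))
    (hd : ∀ T, 0 ≤ T → d T = d 0 + ∫ s in (0 : ℝ)..T, g s)
    (hgC : ∀ T, 0 ≤ T → ∫ s in (0 : ℝ)..T, g s ^ 2 ≤ C)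
    (hdC : ∀ T, 0 ≤ T → ∫ s in (0 : ℝ)..T, d s ^ 2 ≤ C) : Tendsto d atTop (𝓝 0) := by
  have hdL : ∀ T, 0 ≤ T → MemLp d 2 (volume.restrict (Icc 0 T)) := fun T hT =>
    memLp_two_of_continuousOn (continuousOn_of_eq_integral hT
      (intervalIntegrable_of_memLp hT (hg T hT))
      fun τ hτ => hd τ hτ.1)
  have hd2 : IntegrableOn (fun s => d s ^ 2) (Ioi 0) := by
    refine integrableOn_Ioi_of_integral_norm_le (C := C)
      (fun T hT => intervalIntegrable_sq_of_memLp hT (hdL T hT)) fun T hT => ?_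
    simpa using hdC T hT
  have hdg : IntegrableOn (fun s => 2 * (d s * g s)) (Ioi 0) := by
    refine integrableOn_Ioi_of_integral_norm_le (C := C + C)
      (fun T hT => (intervalIntegrable_mul_of_memLp hT (hdL T hT) (hg T hT)).const_mul 2)
      fun T hT => ?_
    refine le_trans ?_ (add_le_add (hdC T hT) (hgC T hT))
    rw [← intervalIntegral.integral_add (intervalIntegrable_sq_of_memLp hT (hdL T hT))
      (intervalIntegrable_sq_of_memLp hT (hg T hT))]
    refine intervalIntegral.integral_mono_on hT
      ((intervalIntegrable_mul_of_memLp hT (hdL T hT) (hg T hT)).const_mul 2).norm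
      ((intervalIntegrable_sq_of_memLp hT (hdL T hT)).add
        (intervalIntegrable_sq_of_memLp hT (hg T hT))) fun s _ => ?_
    rw [Real.norm_eq_abs, abs_le]
    constructor <;> nlinarith [sq_nonneg (d s + g s), sq_nonneg (d s - g s)]
  have hlim := intervalIntegral_tendsto_integral_Ioi 0 hdg tendsto_id
  -- As `2 d d'` is integrable, `d²` has a limit; since `d²` is itself integrable, that limit must
  -- be zero.
  have hlim2 : Tendsto (fun s => d s ^ 2) atTop
      (𝓝 (d 0 ^ 2 + ∫ s in Ioi (0 : ℝ), 2 * (d s * g s))) := by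
    refine (hlim.const_add (d 0 ^ 2)).congr' ?_
    filter_upwards [eventually_ge_atTop 0] with T hT
    exact (sq_eq_of_eq_integral hT (intervalIntegrable_of_memLp hT (hg T hT))
      fun τ hτ => hd τ hτ.1).symm
  have h0 := IntegrableAtFilter.eq_zero_of_tendsto (μ := volume) ⟨Ioi 0, Ioi_mem_atTop 0, hd2⟩
    (fun s hs => by
      rcases mem_atTop_sets.1 hs with ⟨b, hb⟩
      rw [← top_le_iff, ← Real.volume_Ici (a := b)]
      exact measure_mono hb) hlim2
  rw [h0] at hlim2
  have h3 := hlim2.sqrt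
  simp only [Real.sqrt_sq_eq_abs, Real.sqrt_zero] at h3
  exact (tendsto_zero_iff_abs_tendsto_zero _).2 h3

/-- If `X` moves by at least `m` on `[p, q]` and its derivative has square integral at most `C`,
then `q - p` is bounded below. -/
theorem sub_lower_bound_of_integral_sq_le {X u : ℝ → ℝ} {p q m C : ℝ} (hp : 0 ≤ p) (hpq : p ≤ q)
    (hu : MemLp u 2 (volume.restrict (Icc 0 q)))
    (hX : ∀ τ ∈ Icc 0 q, X τ = X 0 + ∫ s in (0 : ℝ)..τ, u s)
    (hC : ∫ s in (0 : ℝ)..q, u s ^ 2 ≤ C) (hCpos : 0 < C) (hm : m ≤ (X q - X p) ^ 2) :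
    m / C ≤ q - p := by
  have hq : 0 ≤ q := hp.trans hpq
  have hu0 := intervalIntegrable_of_memLp hq hu
  have hu2 := intervalIntegrable_sq_of_memLp hq hu
  have hsub : uIcc p q ⊆ uIcc 0 q := by
    rw [uIcc_of_le hpq, uIcc_of_le hq]; exact Icc_subset_Icc_left hp
  have hsub' : uIcc 0 p ⊆ uIcc 0 q := by
    rw [uIcc_of_le hp, uIcc_of_le hq]; exact Icc_subset_Icc_right hpq
  have hw : X q - X p = ∫ s in p..q, u s := by
    rw [hX q ⟨hq, le_rfl⟩, hX p ⟨hp, hpq⟩,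
      ← intervalIntegral.integral_add_adjacent_intervals (hu0.mono_set hsub')
        (hu0.mono_set hsub)]
    ring
  have hCpq : ∫ s in p..q, u s ^ 2 ≤ C := by
    have h0 : 0 ≤ ∫ s in (0 : ℝ)..p, u s ^ 2 :=
      intervalIntegral.integral_nonneg hp fun s _ => sq_nonneg _
    rw [← intervalIntegral.integral_add_adjacent_intervals (hu2.mono_set hsub')
        (hu2.mono_set hsub)] at hC
    linarith
  rw [div_le_iff₀ hCpos]
  rcases hpq.eq_or_lt with rfl | hlt
  · simpa using hm
  have hD : 0 < q - p := sub_pos.2 hlt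
  set w := X q - X p with hwdef
  -- Cauchy–Schwarz in variance form: the integrand is the squared deviation of `u` from its mean `w
  -- / (q - p)`.
  have hvar : 0 ≤ ∫ s in p..q, (u s ^ 2 - 2 * (w / (q - p)) * u s + (w / (q - p)) ^ 2) :=
    intervalIntegral.integral_nonneg hpq fun s _ => by
      nlinarith [sq_nonneg (u s - w / (q - p))]
  rw [intervalIntegral.integral_add ((hu2.mono_set hsub).sub
      ((hu0.mono_set hsub).const_mul _)) intervalIntegrable_const,
    intervalIntegral.integral_sub (hu2.mono_set hsub) ((hu0.mono_set hsub).const_mul _),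
    intervalIntegral.integral_const_mul, ← hw, intervalIntegral.integral_const, smul_eq_mul] at hvar
  have h1 : w ^ 2 ≤ (q - p) * ∫ s in p..q, u s ^ 2 := by
    have h2 : (q - p) * (w / (q - p)) = w := by field_simp
    have h3 := mul_nonneg hD.le hvar
    have h4 : (q - p) * ((∫ s in p..q, u s ^ 2) - 2 * (w / (q - p)) * w +
        (q - p) * (w / (q - p)) ^ 2) = (q - p) * (∫ s in p..q, u s ^ 2) - 2 * w *
        ((q - p) * (w / (q - p))) + ((q - p) * (w / (q - p))) ^ 2 := by ring
    rw [h4, h2] at h3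
    nlinarith
  nlinarith

end Analysis

/-! ### Bounded operators and truncations -/

/-- A linear operator of finite gain is bounded: the offset plays no role. -/
theorem GainAtMost.norm_le {Δ : L2Signal →ₗ[ℝ] L2Signal} {δ : ℝ} (h : GainAtMost Δ δ)
    (f : L2Signal) : ‖Δ f‖ ≤ δ * ‖f‖ := by
  obtain ⟨b, hb⟩ := h
  by_contra! hlt
  obtain ⟨n, hn⟩ := exists_nat_gt (b / (‖Δ f‖ - δ * ‖f‖))
  have hpos : 0 < ‖Δ f‖ - δ * ‖f‖ := sub_pos.2 hlt
  rw [div_lt_iff₀ hpos] at hn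
  -- Scaling the input by a large `n` makes any excess over `δ ‖f‖` outgrow the fixed offset.
  have h1 := hb ((n : ℝ) • f)
  rw [map_smul, norm_smul, norm_smul, Real.norm_natCast] at h1
  nlinarith

theorem L2Signal.norm_sq_eq (f : L2Signal) : ‖f‖ ^ 2 = ∫ s in Ici (0 : ℝ), f s ^ 2 := by
  rw [← real_inner_self_eq_norm_sq, L2.inner_def]
  refine integral_congr_ae (Eventually.of_forall fun s => ?_)
  simp [pow_two]

theorem memLp_indicator_Icc {τ : ℝ} {u : ℝ → ℝ} (hu : MemLp u 2 (volume.restrict (Icc 0 τ))) :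
    MemLp ((Icc 0 τ).indicator u) 2 (volume.restrict (Ici (0 : ℝ))) := by
  rw [memLp_indicator_iff_restrict measurableSet_Icc, Measure.restrict_restrict measurableSet_Icc,
    inter_eq_self_of_subset_left Icc_subset_Ici_self]
  exact hu

theorem norm_trunc_sq {τ : ℝ} {u : ℝ → ℝ} (hu : MemLp u 2 (volume.restrict (Icc 0 τ))) :
    ‖trunc τ u‖ ^ 2 = ∫ s in Icc 0 τ, u s ^ 2 := by
  have h := memLp_indicator_Icc hu
  rw [L2Signal.norm_sq_eq, trunc, dif_pos h]
  calc ∫ s in Ici (0 : ℝ), (h.toLp : L2Signal) s ^ 2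
      = ∫ s in Ici (0 : ℝ), (Icc 0 τ).indicator (fun s => u s ^ 2) s := by
        refine integral_congr_ae ?_
        filter_upwards [h.coeFn_toLp] with s hs
        rw [hs]
        by_cases hsτ : s ∈ Icc 0 τ
        · simp [indicator_of_mem hsτ]
        · simp [indicator_of_notMem hsτ]
    _ = ∫ s in Icc 0 τ, u s ^ 2 := by
        rw [integral_indicator measurableSet_Icc, Measure.restrict_restrict measurableSet_Icc,
          inter_eq_self_of_subset_left Icc_subset_Ici_self]

theorem trunc_neg {τ : ℝ} {u : ℝ → ℝ} (hu : MemLp u 2 (volume.restrict (Icc 0 τ))) :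
    trunc τ (-u) = -trunc τ u := by
  have h := memLp_indicator_Icc hu
  have h' := memLp_indicator_Icc hu.neg
  rw [trunc, trunc, dif_pos h, dif_pos h', ← MemLp.toLp_neg]
  exact MemLp.toLp_congr _ _ (by rw [indicator_neg'])

theorem IsOutput.memLp {Δ : L2Signal →ₗ[ℝ] L2Signal} {T : EReal} {u v : ℝ → ℝ}
    (h : IsOutput Δ T u v) {τ : ℝ} (hτ : (τ : EReal) < T) :
    MemLp v 2 (volume.restrict (Icc 0 τ)) :=
  ((Lp.memLp (Δ (trunc τ u))).mono_measure
    (Measure.restrict_mono Icc_subset_Ici_self le_rfl)).ae_eq (h τ hτ).symm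

/-- On `[0, τ]` the signal `v` is a restriction of `Δ (trunc τ u)`, and the norm of the truncation
is the energy of `u` on `[0, τ]`. A bound on each finite interval is needed because the energy of
`u` is not yet known to be finite. -/
theorem IsOutput.integral_sq_le {Δ : L2Signal →ₗ[ℝ] L2Signal} {T : EReal} {u v : ℝ → ℝ}
    (h : IsOutput Δ T u v) {γ : ℝ} (hγ : ∀ f, ‖Δ f‖ ≤ γ * ‖f‖) {τ : ℝ} (hτ0 : 0 ≤ τ)
    (hτ : (τ : EReal) < T) (hu : MemLp u 2 (volume.restrict (Icc 0 τ))) :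
    ∫ s in (0 : ℝ)..τ, v s ^ 2 ≤ γ ^ 2 * ∫ s in (0 : ℝ)..τ, u s ^ 2 := by
  rw [intervalIntegral.integral_of_le hτ0, intervalIntegral.integral_of_le hτ0,
    ← integral_Icc_eq_integral_Ioc, ← integral_Icc_eq_integral_Ioc, ← norm_trunc_sq hu]
  calc ∫ s in Icc 0 τ, v s ^ 2 = ∫ s in Icc 0 τ, (Δ (trunc τ u)) s ^ 2 := by
        refine integral_congr_ae ?_
        filter_upwards [h τ hτ] with s hs using by rw [hs]
    _ ≤ ∫ s in Ici (0 : ℝ), (Δ (trunc τ u)) s ^ 2 :=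
        setIntegral_mono_set (Lp.memLp (Δ (trunc τ u))).integrable_sq
          (Eventually.of_forall fun s => sq_nonneg _) Icc_subset_Ici_self.eventuallyLE
    _ = ‖Δ (trunc τ u)‖ ^ 2 := (L2Signal.norm_sq_eq _).symm
    _ ≤ (γ * ‖trunc τ u‖) ^ 2 := pow_le_pow_left₀ (norm_nonneg _) (hγ _) 2
    _ = γ ^ 2 * ‖trunc τ u‖ ^ 2 := mul_pow _ _ _

/-- Linearity carries the sign from input to output. Applied to the two orientations of an edge it
yields the antisymmetry that summation by parts requires. -/
theorem IsOutput.ae_eq_neg {Δ : L2Signal →ₗ[ℝ] L2Signal} {T : EReal} {u v u' v' : ℝ → ℝ}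
    (h : IsOutput Δ T u v) (h' : IsOutput Δ T u' v') (hu' : u' = -u) {τ : ℝ}
    (hτ : (τ : EReal) < T) (hu : MemLp u 2 (volume.restrict (Icc 0 τ))) :
    ∀ᵐ s ∂volume.restrict (Icc 0 τ), v' s = -v s := by
  have h1 := h' τ hτ
  rw [hu', trunc_neg hu, map_neg] at h1
  have h2 := ae_restrict_of_ae_restrict_of_subset (show Icc 0 τ ⊆ Ici 0 from Icc_subset_Ici_self)
    (Lp.coeFn_neg (Δ (trunc τ u)))
  filter_upwards [h1, h2, h τ hτ] with s h1 h2 h3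
  rw [h1, h2, h3, Pi.neg_apply]

/-! ### Regularity and almost-everywhere relations along a trajectory -/

namespace Trajectory

variable {N : ℕ} {G : WeightedGraph N} {Δ : Fin N → Fin N → L2Signal →ₗ[ℝ] L2Signal}
  {α β μ ν : ℝ} (S : Trajectory G Δ α β μ ν)

/-- The control inputs along a trajectory. -/
def input (i : Fin N) (s : ℝ) : ℝ :=
  -β * ∑ j, G.a i j * (S.xhat i s - S.xhat j s) - β * ∑ j, G.a i j * S.v i j s

/-- The disagreement of the estimates along the edges. -/
def disagreement (s : ℝ) : ℝ := ∑ i, ∑ j, G.a i j * (S.xhat i s - S.xhat j s) ^ 2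

theorem t_mono (i : Fin N) : Monotone (S.t i) := by
  refine monotone_nat_of_le_succ fun k => ?_
  by_cases h : S.t i k = ⊤
  · rw [S.t_top i k h, h]
  · exact (S.t_lt_succ i k h).le

theorem t_nonneg (i : Fin N) (k : ℕ) : 0 ≤ S.t i k :=
  (S.t_zero i).symm.le.trans (S.t_mono i (Nat.zero_le k))

theorem coe_toReal_t {i : Fin N} {k : ℕ} (h : S.t i k ≠ ⊤) : ((S.t i k).toReal : EReal) = S.t i k :=
  EReal.coe_toReal h (ne_bot_of_le_ne_bot (by simp) (S.t_nonneg i k))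

theorem exists_lt_t {s : ℝ} (hs : (s : EReal) < horizon S.t) (i : Fin N) :
    ∃ k, (s : EReal) < S.t i k :=
  lt_iSup_iff.1 (hs.trans_le (iInf_le _ i))

theorem exists_index {s : ℝ} (hs0 : 0 ≤ s) (hs : (s : EReal) < horizon S.t) (i : Fin N) :
    ∃ k, S.t i k ≤ s ∧ (s : EReal) < S.t i (k + 1) := by
  classical
  have hex := S.exists_lt_t hs i
  -- The wanted index precedes the first instant beyond `s`; it exists because the instant of index
  -- `0` is at most `s`.
  have hpos : Nat.find hex ≠ 0 := fun h0 => by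
    have h1 := Nat.find_spec hex
    rw [h0, S.t_zero] at h1
    exact absurd hs0 (not_le.2 (by exact_mod_cast h1))
  obtain ⟨k, hk⟩ := Nat.exists_eq_succ_of_ne_zero hpos
  refine ⟨k, not_lt.1 (Nat.find_min hex (by omega)), ?_⟩
  have := Nat.find_spec hex
  rwa [hk] at this

/-- On compact intervals before the horizon the estimates are step functions. -/
theorem memLp_xhat {τ : ℝ} (hτ : (τ : EReal) < horizon S.t) (i : Fin N) :
    MemLp (S.xhat i) 2 (volume.restrict (Icc 0 τ)) := by
  obtain ⟨K, hK⟩ := S.exists_lt_t hτ i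
  let I : ℕ → Set ℝ := fun k => {s : ℝ | S.t i k ≤ s ∧ (s : EReal) < S.t i (k + 1)}
  have hI : ∀ k, MeasurableSet (I k) := fun k =>
    measurable_coe_real_ereal measurableSet_Ico
  have hσ : MemLp (fun s => ∑ k ∈ Finset.range K,
      (I k).indicator (fun _ => S.x i (S.t i k).toReal) s) 2 (volume.restrict (Icc 0 τ)) :=
    memLp_finsetSum _ fun k _ => (memLp_const _).indicator (hI k)
  refine hσ.ae_eq ((ae_restrict_iff' measurableSet_Icc).2 (Eventually.of_forall fun s hs => ?_))
  have hsT : (s : EReal) < horizon S.t := lt_of_le_of_lt (EReal.coe_le_coe_iff.2 hs.2) hτ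
  obtain ⟨k, hk1, hk2⟩ := S.exists_index hs.1 hsT i
  have hkK : k < K := by
    by_contra! h
    exact absurd ((S.t_mono i h).trans hk1)
      (not_le.2 (lt_of_le_of_lt (EReal.coe_le_coe_iff.2 hs.2) hK))
  rw [Finset.sum_eq_single k, indicator_of_mem (show s ∈ I k from ⟨hk1, hk2⟩),
    S.hold i k s hk1 hk2 hsT]
  · intro l _ hl
    refine indicator_of_notMem (fun hmem => ?_) _
    rcases hl.lt_or_gt with h | h
    · exact absurd ((S.t_mono i (Nat.succ_le_of_lt h)).trans hk1) (not_le.2 hmem.2)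
    · exact absurd ((S.t_mono i (Nat.succ_le_of_lt h)).trans hmem.1) (not_le.2 hk2)
  · intro h
    exact absurd (Finset.mem_range.2 hkK) h

theorem memLp_xhat_sub {τ : ℝ} (hτ : (τ : EReal) < horizon S.t) (i j : Fin N) :
    MemLp (fun s => S.xhat i s - S.xhat j s) 2 (volume.restrict (Icc 0 τ)) :=
  (S.memLp_xhat hτ i).sub (S.memLp_xhat hτ j)

theorem memLp_input {τ : ℝ} (hτ : (τ : EReal) < horizon S.t) (i : Fin N) :
    MemLp (S.input i) 2 (volume.restrict (Icc 0 τ)) := by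
  have hz : MemLp (fun s => ∑ j, G.a i j * (S.xhat i s - S.xhat j s)) 2
      (volume.restrict (Icc 0 τ)) :=
    memLp_finsetSum _ fun j _ => (S.memLp_xhat_sub hτ i j).const_mul (G.a i j)
  have hv : MemLp (fun s => ∑ j, G.a i j * S.v i j s) 2 (volume.restrict (Icc 0 τ)) := by
    refine memLp_finsetSum _ fun j _ => ?_
    rcases (G.nonneg i j).eq_or_lt with h | h
    · simp [← h]
    · exact ((S.output i j h).memLp hτ).const_mul (G.a i j)
  exact (hz.const_mul (-β)).sub (hv.const_mul β)

theorem coe_lt_horizon {s τ : ℝ} (hs : s ≤ τ) (hτ : (τ : EReal) < horizon S.t) :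
    (s : EReal) < horizon S.t :=
  lt_of_le_of_lt (EReal.coe_le_coe_iff.2 hs) hτ

theorem x_eq_integral {τ : ℝ} (hτ0 : 0 ≤ τ) (hτ : (τ : EReal) < horizon S.t) (i : Fin N) :
    S.x i τ = S.x i 0 + ∫ s in (0 : ℝ)..τ, S.input i s :=
  S.dynamics i τ hτ0 hτ

/-- The triggering function is negative strictly between events, and the triggering instants of all
agents form a countable, hence null, set. -/
theorem ae_trigger {τ : ℝ} (hτ : (τ : EReal) < horizon S.t) :
    ∀ᵐ s ∂volume.restrict (Icc 0 τ), ∀ i, (S.xhat i s - S.x i s) ^ 2 ≤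
      α * ∑ j, G.a i j * (S.xhat i s - S.xhat j s) ^ 2 + μ * Real.exp (-ν * s) := by
  have hcount : {s : ℝ | ∃ i k, S.t i k = s}.Countable := by
    simp only [ofPred_exists]
    exact countable_iUnion fun i => countable_iUnion fun k =>
      Set.Subsingleton.countable fun s hs s' hs' =>
        EReal.coe_eq_coe_iff.1 (Eq.trans (Eq.symm hs) hs')
  filter_upwards [ae_restrict_of_ae (hcount.ae_notMem volume), ae_restrict_mem measurableSet_Icc]
    with s hs hsτ i
  have hsT := S.coe_lt_horizon hsτ.2 hτ
  obtain ⟨k, hk1, hk2⟩ := S.exists_index hsτ.1 hsT i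
  have h := S.no_event i k s (lt_of_le_of_ne hk1 fun h => hs ⟨i, k, h⟩) hk2 hsT
  linarith

theorem ae_v_antisymm (hΔ : ∀ i j, 0 < G.a i j → Δ i j = Δ j i) {τ : ℝ}
    (hτ : (τ : EReal) < horizon S.t) :
    ∀ᵐ s ∂volume.restrict (Icc 0 τ), ∀ i j, 0 < G.a i j → S.v j i s = -S.v i j s := by
  refine ae_all_iff.2 fun i => ae_all_iff.2 fun j => ?_
  by_cases hij : 0 < G.a i j
  · have hout := S.output j i (by rwa [G.a_comm])
    rw [← hΔ i j hij] at hout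
    filter_upwards [(S.output i j hij).ae_eq_neg hout (by ext s; simp) hτ
      (S.memLp_xhat_sub hτ i j)] with s hs _ using hs
  · exact Eventually.of_forall fun s h => absurd h hij

theorem intervalIntegrable_disagreement {τ : ℝ} (hτ0 : 0 ≤ τ) (hτ : (τ : EReal) < horizon S.t) :
    IntervalIntegrable S.disagreement volume 0 τ := by
  rw [intervalIntegrable_iff_integrableOn_Icc_of_le hτ0]
  exact integrable_finsetSum _ fun i _ => integrable_finsetSum _ fun j _ =>
    (S.memLp_xhat_sub hτ i j).integrable_sq.const_mul _

theorem intervalIntegrable_edge_output_sq {τ : ℝ} (hτ0 : 0 ≤ τ) (hτ : (τ : EReal) < horizon S.t)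
    (i j : Fin N) : IntervalIntegrable (fun s => G.a i j * S.v i j s ^ 2) volume 0 τ := by
  rcases (G.nonneg i j).eq_or_lt with h | h
  · simp [← h]
  · exact (intervalIntegrable_sq_of_memLp hτ0 ((S.output i j h).memLp hτ)).const_mul _

theorem intervalIntegrable_output_sq {τ : ℝ} (hτ0 : 0 ≤ τ) (hτ : (τ : EReal) < horizon S.t) :
    IntervalIntegrable (fun s => ∑ i, ∑ j, G.a i j * S.v i j s ^ 2) volume 0 τ := by
  rw [intervalIntegrable_iff_integrableOn_Icc_of_le hτ0]
  exact integrable_finsetSum _ fun i _ => integrable_finsetSum _ fun j _ =>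
    (intervalIntegrable_iff_integrableOn_Icc_of_le hτ0).1
      (S.intervalIntegrable_edge_output_sq hτ0 hτ i j)

theorem integral_output_sq_le {γ : ℝ}
    (hΔ : ∀ i j, 0 < G.a i j → ∀ f, ‖Δ i j f‖ ≤ γ * ‖f‖) {τ : ℝ} (hτ0 : 0 ≤ τ)
    (hτ : (τ : EReal) < horizon S.t) :
    ∫ s in (0 : ℝ)..τ, ∑ i, ∑ j, G.a i j * S.v i j s ^ 2 ≤
      γ ^ 2 * ∫ s in (0 : ℝ)..τ, S.disagreement s := by
  have hz : ∀ i j, IntervalIntegrable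
      (fun s => G.a i j * (S.xhat i s - S.xhat j s) ^ 2) volume 0 τ := fun i j =>
    (intervalIntegrable_sq_of_memLp hτ0 (S.memLp_xhat_sub hτ i j)).const_mul _
  have hv := fun i j => S.intervalIntegrable_edge_output_sq hτ0 hτ i j
  have hsum : ∀ F : Fin N → Fin N → ℝ → ℝ, (∀ i j, IntervalIntegrable (F i j) volume 0 τ) →
      ∫ s in (0 : ℝ)..τ, ∑ i, ∑ j, F i j s = ∑ i, ∑ j, ∫ s in (0 : ℝ)..τ, F i j s := by
    intro F hF
    rw [intervalIntegral.integral_finsetSum]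
    · exact Finset.sum_congr rfl fun i _ =>
        intervalIntegral.integral_finsetSum fun j _ => hF i j
    · intro i _
      rw [intervalIntegrable_iff_integrableOn_Icc_of_le hτ0]
      exact integrable_finsetSum _ fun j _ =>
        (intervalIntegrable_iff_integrableOn_Icc_of_le hτ0).1 (hF i j)
  simp only [disagreement]
  rw [hsum _ hv, hsum _ hz]
  simp only [Finset.mul_sum]
  refine Finset.sum_le_sum fun i _ => Finset.sum_le_sum fun j _ => ?_
  rw [intervalIntegral.integral_const_mul, intervalIntegral.integral_const_mul]
  rcases (G.nonneg i j).eq_or_lt with h | h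
  · simp [← h]
  · have := mul_le_mul_of_nonneg_left ((S.output i j h).integral_sq_le (hΔ i j h) hτ0 hτ
      (S.memLp_xhat_sub hτ i j)) h.le
    linarith

/-! ### Energy estimates up to the horizon -/

theorem intervalIntegrable_exp (c ν a b : ℝ) :
    IntervalIntegrable (fun s => c * Real.exp (-ν * s)) volume a b :=
  (by fun_prop : Continuous fun s => c * Real.exp (-ν * s)).intervalIntegrable a b

theorem integral_exp_le {c ν τ : ℝ} (hc : 0 ≤ c) (hν : 0 < ν) :
    ∫ s in (0 : ℝ)..τ, c * Real.exp (-ν * s) ≤ c / ν := by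
  have h : ∀ s ∈ uIcc 0 τ, HasDerivAt (fun s => -(c / ν) * Real.exp (-ν * s))
      (c * Real.exp (-ν * s)) s := fun s _ => by
    have h1 : HasDerivAt (fun s : ℝ => -ν * s) (-ν) s := by
      simpa using (hasDerivAt_id s).const_mul (-ν)
    have h2 := h1.exp.const_mul (-(c / ν))
    refine h2.congr_deriv ?_
    field_simp
  rw [intervalIntegral.integral_eq_sub_of_hasDerivAt h (intervalIntegrable_exp c ν 0 τ)]
  have : 0 ≤ c / ν * Real.exp (-ν * τ) := by positivity
  simp only [mul_zero, Real.exp_zero]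
  linarith

/-- The disagreement of the estimates along the edges is integrable up to the horizon. -/
theorem integral_disagreement_le (hN : 2 ≤ N) (hβ : 0 < β) (hμ : 0 < μ) (hν : 0 < ν) {γ : ℝ}
    (hsymm : ∀ i j, 0 < G.a i j → Δ i j = Δ j i)
    (hΔ : ∀ i j, 0 < G.a i j → ∀ f, ‖Δ i j f‖ ≤ γ * ‖f‖)
    (hγ : 2 * α * G.lambdaMax hN ≤ γ ^ 2) {τ : ℝ} (hτ0 : 0 ≤ τ) (hτ : (τ : EReal) < horizon S.t) :
    (1 - 2 * γ ^ 2) * ∫ s in (0 : ℝ)..τ, S.disagreement s ≤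
      2 / β * ∑ i, S.x i 0 ^ 2 + 2 * G.lambdaMax hN * N * (μ / ν) := by
  have hu := fun i => S.memLp_input hτ i
  have hX : ∀ i, ∀ s ∈ Icc 0 τ, S.x i s = S.x i 0 + ∫ r in (0 : ℝ)..s, S.input i r :=
    fun i s hs => S.x_eq_integral hs.1 (S.coe_lt_horizon hs.2 hτ) i
  have hx : ∀ i, MemLp (S.x i) 2 (volume.restrict (Icc 0 τ)) := fun i =>
    memLp_two_of_continuousOn (continuousOn_of_eq_integral hτ0
      (intervalIntegrable_of_memLp hτ0 (hu i)) (hX i))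
  have hxu : ∀ i, IntervalIntegrable (fun s => 2 * (S.x i s * S.input i s)) volume 0 τ := fun i =>
    (intervalIntegrable_mul_of_memLp hτ0 (hx i) (hu i)).const_mul 2
  have hE : ∑ i, S.x i τ ^ 2 = ∑ i, S.x i 0 ^ 2 +
      ∫ s in (0 : ℝ)..τ, ∑ i, 2 * (S.x i s * S.input i s) := by
    rw [intervalIntegral.integral_finsetSum fun i _ => hxu i, ← Finset.sum_add_distrib]
    exact Finset.sum_congr rfl fun i _ =>
      sq_eq_of_eq_integral hτ0 (intervalIntegrable_of_memLp hτ0 (hu i)) (hX i)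
  have hl : 0 ≤ G.lambdaMax hN := (G.lambdaTwo_nonneg hN).trans (G.lambdaTwo_le_lambdaMax hN)
  have hz := S.intervalIntegrable_disagreement hτ0 hτ
  have hv := S.intervalIntegrable_output_sq hτ0 hτ
  have he := intervalIntegrable_exp μ ν 0 τ
  have hle : ∫ s in (0 : ℝ)..τ, ∑ i, 2 * (S.x i s * S.input i s) ≤
      ∫ s in (0 : ℝ)..τ, β / 2 * ((γ ^ 2 - 1) * S.disagreement s +
        ∑ i, ∑ j, G.a i j * S.v i j s ^ 2 +
          2 * G.lambdaMax hN * N * (μ * Real.exp (-ν * s))) := by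
    refine intervalIntegral.integral_mono_ae_restrict hτ0 ?_
      ((((hz.const_mul _).add hv).add (he.const_mul _)).const_mul _) ?_
    · rw [intervalIntegrable_iff_integrableOn_Icc_of_le hτ0]
      exact integrable_finsetSum _ fun i _ =>
        (intervalIntegrable_iff_integrableOn_Icc_of_le hτ0).1 (hxu i)
    · filter_upwards [S.ae_trigger hτ, S.ae_v_antisymm hsymm hτ] with s hs1 hs2
      have := G.dissipation hN hβ.le hγ (fun i => S.x i s) (fun i => S.xhat i s)
        (fun i j => S.v i j s) hs2 hs1
      rwa [Finset.mul_sum] at this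
  rw [intervalIntegral.integral_const_mul,
    intervalIntegral.integral_add ((hz.const_mul _).add hv) (he.const_mul _),
    intervalIntegral.integral_add (hz.const_mul _) hv, intervalIntegral.integral_const_mul,
    intervalIntegral.integral_const_mul] at hle
  have h1 := S.integral_output_sq_le hΔ hτ0 hτ
  have h2 : 2 * G.lambdaMax hN * N * (∫ s in (0 : ℝ)..τ, μ * Real.exp (-ν * s)) ≤
      2 * G.lambdaMax hN * N * (μ / ν) :=
    mul_le_mul_of_nonneg_left (integral_exp_le hμ.le hν) (by positivity)
  have h3 : 0 ≤ ∑ i, S.x i τ ^ 2 := Finset.sum_nonneg fun i _ => sq_nonneg _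
  have h4 := mul_le_mul_of_nonneg_left (add_le_add h1 h2) (half_pos hβ).le
  -- One `γ²` comes from the trigger and one from the gain; the final value of the storage function
  -- is dropped as nonnegative.
  have h5 : 0 ≤ ∑ i, S.x i 0 ^ 2 + β / 2 * ((2 * γ ^ 2 - 1) *
      (∫ s in (0 : ℝ)..τ, S.disagreement s) + 2 * G.lambdaMax hN * N * (μ / ν)) := by
    nlinarith
  have h6 := mul_nonneg (show 0 ≤ 2 / β by positivity) h5
  have h7 : 2 / β * (∑ i, S.x i 0 ^ 2 + β / 2 * ((2 * γ ^ 2 - 1) *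
      (∫ s in (0 : ℝ)..τ, S.disagreement s) + 2 * G.lambdaMax hN * N * (μ / ν))) =
      2 / β * ∑ i, S.x i 0 ^ 2 + ((2 * γ ^ 2 - 1) *
      (∫ s in (0 : ℝ)..τ, S.disagreement s) + 2 * G.lambdaMax hN * N * (μ / ν)) := by
    field_simp
  linarith

theorem integral_input_sq_le {γ : ℝ}
    (hΔ : ∀ i j, 0 < G.a i j → ∀ f, ‖Δ i j f‖ ≤ γ * ‖f‖) {τ : ℝ} (hτ0 : 0 ≤ τ)
    (hτ : (τ : EReal) < horizon S.t) (i : Fin N) :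
    ∫ s in (0 : ℝ)..τ, S.input i s ^ 2 ≤
      2 * β ^ 2 * (∑ j, G.a i j) * ((1 + γ ^ 2) * ∫ s in (0 : ℝ)..τ, S.disagreement s) := by
  have hz := S.intervalIntegrable_disagreement hτ0 hτ
  have hv := S.intervalIntegrable_output_sq hτ0 hτ
  have h1 : ∫ s in (0 : ℝ)..τ, S.input i s ^ 2 ≤
      ∫ s in (0 : ℝ)..τ, 2 * β ^ 2 * (∑ j, G.a i j) *
        (S.disagreement s + ∑ k, ∑ j, G.a k j * S.v k j s ^ 2) :=
    intervalIntegral.integral_mono_on hτ0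
      (intervalIntegrable_sq_of_memLp hτ0 (S.memLp_input hτ i)) ((hz.add hv).const_mul _)
      fun s _ => G.sq_input_le (fun i => S.xhat i s) (fun i j => S.v i j s) i
  rw [intervalIntegral.integral_const_mul, intervalIntegral.integral_add hz hv] at h1
  have hD : 0 ≤ ∑ j, G.a i j := Finset.sum_nonneg fun j _ => G.nonneg i j
  refine h1.trans (mul_le_mul_of_nonneg_left ?_ (by positivity))
  linarith [S.integral_output_sq_le hΔ hτ0 hτ]

theorem integral_sq_sub_le (hN : 2 ≤ N) (hμ : 0 < μ) (hν : 0 < ν) {γ : ℝ}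
    (hγ : 2 * α * G.lambdaMax hN ≤ γ ^ 2) {τ : ℝ} (hτ0 : 0 ≤ τ) (hτ : (τ : EReal) < horizon S.t)
    (i j : Fin N) :
    G.a i j * ∫ s in (0 : ℝ)..τ, (S.x i s - S.x j s) ^ 2 ≤
      2 * ((1 + γ ^ 2) * (∫ s in (0 : ℝ)..τ, S.disagreement s) +
        2 * G.lambdaMax hN * N * (μ / ν)) := by
  have hx : ∀ i, MemLp (S.x i) 2 (volume.restrict (Icc 0 τ)) := fun i =>
    memLp_two_of_continuousOn (continuousOn_of_eq_integral hτ0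
      (intervalIntegrable_of_memLp hτ0 (S.memLp_input hτ i))
      fun s hs => S.x_eq_integral hs.1 (S.coe_lt_horizon hs.2 hτ) i)
  have hz := S.intervalIntegrable_disagreement hτ0 hτ
  have he := intervalIntegrable_exp μ ν 0 τ
  have hl : 0 ≤ G.lambdaMax hN := (G.lambdaTwo_nonneg hN).trans (G.lambdaTwo_le_lambdaMax hN)
  have hle : ∫ s in (0 : ℝ)..τ, G.a i j * (S.x i s - S.x j s) ^ 2 ≤
      ∫ s in (0 : ℝ)..τ, 2 * ((1 + γ ^ 2) * S.disagreement s +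
        2 * G.lambdaMax hN * N * (μ * Real.exp (-ν * s))) := by
    refine intervalIntegral.integral_mono_ae_restrict hτ0
      ((intervalIntegrable_sq_of_memLp hτ0 ((hx i).sub (hx j))).const_mul _)
      (((hz.const_mul _).add (he.const_mul _)).const_mul _) ?_
    filter_upwards [S.ae_trigger hτ] with s hs using
      G.sq_sub_le_of_edge hN hγ (fun i => S.x i s) (fun i => S.xhat i s) hs i j
  rw [intervalIntegral.integral_const_mul, intervalIntegral.integral_const_mul,
    intervalIntegral.integral_add (hz.const_mul _) (he.const_mul _),
    intervalIntegral.integral_const_mul, intervalIntegral.integral_const_mul] at hle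
  have h2 : 2 * G.lambdaMax hN * N * (∫ s in (0 : ℝ)..τ, μ * Real.exp (-ν * s)) ≤
      2 * G.lambdaMax hN * N * (μ / ν) :=
    mul_le_mul_of_nonneg_left (integral_exp_le hμ.le hν) (by positivity)
  linarith

/-! ### Exclusion of Zeno behavior and consensus -/

/-- If the inputs have bounded energy, then the triggering instants do not accumulate. -/
theorem horizon_eq_top (hN : 2 ≤ N) (hα : 0 ≤ α) (hμ : 0 < μ) (hν : 0 < ν) {C : ℝ} (hC : 0 < C)
    (hu : ∀ i (τ : ℝ), 0 ≤ τ → (τ : EReal) < horizon S.t →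
      ∫ s in (0 : ℝ)..τ, S.input i s ^ 2 ≤ C) : horizon S.t = ⊤ := by
  by_contra htop
  have : Nonempty (Fin N) := ⟨⟨0, by omega⟩⟩
  obtain ⟨i, hi⟩ := exists_eq_ciInf_of_finite (f := fun i => ⨆ k, S.t i k)
  change ⨆ k, S.t i k = horizon S.t at hi
  -- For the agent attaining a finite horizon all instants are finite, hence strictly increasing,
  -- and none reaches the supremum.
  have hlt : ∀ k, S.t i k < horizon S.t := fun k => by
    have h1 : ∀ l, S.t i l ≤ horizon S.t := fun l => hi ▸ le_iSup (S.t i) l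
    exact (S.t_lt_succ i k (ne_top_of_le_ne_top htop (h1 k))).trans_le (h1 (k + 1))
  have hcoe : ∀ k, ((S.t i k).toReal : EReal) = S.t i k := fun k =>
    S.coe_toReal_t (ne_top_of_lt (hlt k))
  have hpos : 0 ≤ horizon S.t := (S.t_nonneg i 0).trans (hlt 0).le
  obtain ⟨T, hT⟩ : ∃ T : ℝ, (T : EReal) = horizon S.t :=
    ⟨_, EReal.coe_toReal htop (ne_bot_of_le_ne_bot (by simp) hpos)⟩
  set r : ℕ → ℝ := fun k => (S.t i k).toReal with hr
  have hr0 : ∀ k, 0 ≤ r k := fun k => by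
    have := S.t_nonneg i k
    rw [← hcoe k] at this
    exact_mod_cast this
  have hrT : ∀ k, r k ≤ T := fun k => by
    have := (hlt k).le
    rw [← hcoe k, ← hT] at this
    exact_mod_cast this
  have hrlt : ∀ k, (r k : EReal) < horizon S.t := fun k => (hcoe k).trans_lt (hlt k)
  have hstep : ∀ k, μ * Real.exp (-ν * T) / C ≤ r (k + 1) - r k := fun k => by
    have hle : r k ≤ r (k + 1) := by
      have := S.t_mono i (Nat.le_succ k)
      rw [← hcoe k, ← hcoe (k + 1)] at this
      exact_mod_cast this
    refine sub_lower_bound_of_integral_sq_le (hr0 k) hle (S.memLp_input (hrlt _) i)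
      (fun s hs => S.x_eq_integral hs.1 (S.coe_lt_horizon hs.2 (hrlt _)) i)
      (hu i _ (hr0 _) (hrlt _)) hC ?_
    -- Whichever estimates `m` selects, the disagreement term is nonnegative. The squared
    -- displacement since the last event is thus at least `μ exp(-νs)` at the event time `s ≤ T`,
    -- hence at least `μ exp(-νT)`.
    obtain ⟨m, -, hm⟩ := S.event i k (r (k + 1)) (hcoe (k + 1)).symm (hrlt _)
    have h1 : 0 ≤ α * ∑ j, G.a i j * (S.x i (r k) - S.x j (S.t j (m j)).toReal) ^ 2 :=
      mul_nonneg hα (Finset.sum_nonneg fun j _ => mul_nonneg (G.nonneg i j) (sq_nonneg _))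
    have h2 : μ * Real.exp (-ν * T) ≤ μ * Real.exp (-ν * r (k + 1)) := by
      have := hrT (k + 1)
      gcongr ?_ * Real.exp ?_
      nlinarith
    have h3 : (S.x i (r (k + 1)) - S.x i (r k)) ^ 2 = (S.x i (r k) - S.x i (r (k + 1))) ^ 2 := by
      ring
    rw [h3]
    linarith
  have hgrow : ∀ k : ℕ, k * (μ * Real.exp (-ν * T) / C) ≤ r k := fun k => by
    induction k with
    | zero => simpa using hr0 0
    | succ k ih =>
      push_cast
      linarith [hstep k]
  have hc : 0 < μ * Real.exp (-ν * T) / C := by positivity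
  obtain ⟨n, hn⟩ := exists_nat_gt (T / (μ * Real.exp (-ν * T) / C))
  rw [div_lt_iff₀ hc] at hn
  linarith [hgrow n, hrT n]

theorem finite_instants_of_horizon_eq_top (h : horizon S.t = ⊤) (i : Fin N) (B : ℝ) :
    {k : ℕ | S.t i k ≤ (B : EReal)}.Finite := by
  obtain ⟨K, hK⟩ := S.exists_lt_t (s := B) (h ▸ EReal.coe_lt_top B) i
  refine (finite_lt_nat K).subset fun k hk => ?_
  by_contra! hle
  exact absurd ((S.t_mono i (not_lt.1 hle)).trans hk) (not_le.2 hK)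

theorem tendsto_sub_of_edge (h : horizon S.t = ⊤) {C : ℝ} {i j : Fin N}
    (hu : ∀ i (τ : ℝ), 0 ≤ τ → ∫ s in (0 : ℝ)..τ, S.input i s ^ 2 ≤ C)
    (hx : ∀ τ : ℝ, 0 ≤ τ → ∫ s in (0 : ℝ)..τ, (S.x i s - S.x j s) ^ 2 ≤ C) :
    Tendsto (fun s => S.x i s - S.x j s) atTop (𝓝 0) := by
  have hlt : ∀ τ : ℝ, (τ : EReal) < horizon S.t := fun τ => h ▸ EReal.coe_lt_top τ
  have hC : 0 ≤ C := by simpa using hx 0 le_rfl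
  -- The factor `4` comes from `(a - b)² ≤ 2(a² + b²)` with both energies at most `C`.
  refine tendsto_zero_of_integral_sq_le (g := fun s => S.input i s - S.input j s) (C := 4 * C)
    (fun T hT => (S.memLp_input (hlt T) i).sub (S.memLp_input (hlt T) j)) (fun T hT => ?_)
    (fun T hT => ?_) fun T hT => (hx T hT).trans (by linarith)
  · rw [intervalIntegral.integral_sub (intervalIntegrable_of_memLp hT (S.memLp_input (hlt T) i))
      (intervalIntegrable_of_memLp hT (S.memLp_input (hlt T) j)),
      S.x_eq_integral hT (hlt T) i, S.x_eq_integral hT (hlt T) j]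
    ring
  · have hi := intervalIntegrable_sq_of_memLp hT (S.memLp_input (hlt T) i)
    have hj := intervalIntegrable_sq_of_memLp hT (S.memLp_input (hlt T) j)
    have h1 : ∫ s in (0 : ℝ)..T, (S.input i s - S.input j s) ^ 2 ≤
        ∫ s in (0 : ℝ)..T, 2 * (S.input i s ^ 2 + S.input j s ^ 2) :=
      intervalIntegral.integral_mono_on hT (intervalIntegrable_sq_of_memLp hT
        ((S.memLp_input (hlt T) i).sub (S.memLp_input (hlt T) j))) ((hi.add hj).const_mul 2)
        fun s _ => by nlinarith [sq_nonneg (S.input i s + S.input j s)]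
    rw [intervalIntegral.integral_const_mul, intervalIntegral.integral_add hi hj] at h1
    linarith [hu i T hT, hu j T hT]

/-- Consensus along the edges of a connected graph is consensus. -/
theorem tendsto_sub_of_connected (hG : G.toSimpleGraph.Connected)
    (h : ∀ i j, 0 < G.a i j → Tendsto (fun s => S.x i s - S.x j s) atTop (𝓝 0)) (i j : Fin N) :
    Tendsto (fun s => S.x i s - S.x j s) atTop (𝓝 0) := by
  obtain ⟨p⟩ := hG.preconnected i j
  induction p with
  | nil => simp
  | @cons u w z hadj _ ih =>
    have hedge : 0 < G.a u w := by
      rcases ((SimpleGraph.fromRel_adj _ _ _).1 hadj).2 with h1 | h1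
      · exact h1
      · rwa [G.a_comm]
    simpa using (h u w hedge).add ih

end Trajectory
end EventTriggered

/-! ### The main theorem -/

open EventTriggered in
/-- Robust event-triggered consensus under multiplicative uncertainties of the edge weights. Every
trajectory exists for all times, reaches consensus and does not exhibit Zeno behavior. -/
theorem theorem5 {N : ℕ} (hN : 2 ≤ N) (G : WeightedGraph N) (hG : G.toSimpleGraph.Connected)
    (Δ : Fin N → Fin N → L2Signal →ₗ[ℝ] L2Signal) (δ : ℝ)
    (hΔsymm : ∀ i j, 0 < G.a i j → Δ i j = Δ j i)
    (hΔcausal : ∀ i j, 0 < G.a i j → Causal (Δ i j))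
    (hΔgain : ∀ i j, 0 < G.a i j → GainAtMost (Δ i j) δ)
    (α β μ ν : ℝ) (hα : 0 < α) (hβ : 0 < β) (hμ : 0 < μ) (hν : 0 < ν)
    (hγ : max δ (Real.sqrt (2 * α * G.lambdaMax hN)) <
      Real.sqrt (G.lambdaTwo hN ^ 2 / (G.lambdaTwo hN ^ 2 + G.lambdaMax hN ^ 2)))
    (S : Trajectory G Δ α β μ ν) :
    horizon S.t = ⊤ ∧
    (∀ i j, Tendsto (fun s => S.x i s - S.x j s) atTop (𝓝 0)) ∧
    (∀ i (B : ℝ), {k : ℕ | S.t i k ≤ (B : EReal)}.Finite) := by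
  have hl2 := G.lambdaTwo_nonneg hN
  have hl2N := G.lambdaTwo_le_lambdaMax hN
  have hlN := hl2.trans hl2N
  set γ := max δ (Real.sqrt (2 * α * G.lambdaMax hN)) with hγdef
  have hγ0 : 0 ≤ γ := le_max_of_le_right (Real.sqrt_nonneg _)
  have hγ2 : 2 * γ ^ 2 < 1 := by
    have h1 := (Real.lt_sqrt hγ0).1 hγ
    -- Because `0 ≤ λ₂ ≤ λ_N`; this is the only way the spectral ratio enters.
    have h2 : G.lambdaTwo hN ^ 2 / (G.lambdaTwo hN ^ 2 + G.lambdaMax hN ^ 2) ≤ 1 / 2 :=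
      div_le_of_le_mul₀ (by positivity) (by norm_num) (by nlinarith)
    linarith
  have hγα : 2 * α * G.lambdaMax hN ≤ γ ^ 2 := by
    rw [← Real.sq_sqrt (show 0 ≤ 2 * α * G.lambdaMax hN by positivity)]
    exact pow_le_pow_left₀ (Real.sqrt_nonneg _) (le_max_right _ _) 2
  have hΔ : ∀ i j, 0 < G.a i j → ∀ f, ‖Δ i j f‖ ≤ γ * ‖f‖ := fun i j hij f =>
    ((hΔgain i j hij).norm_le f).trans
      (mul_le_mul_of_nonneg_right (le_max_left _ _) (norm_nonneg f))
  obtain ⟨C, hC⟩ : ∃ C, ∀ τ : ℝ, 0 ≤ τ → (τ : EReal) < horizon S.t →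
      ∫ s in (0 : ℝ)..τ, S.disagreement s ≤ C :=
    ⟨_, fun τ hτ0 hτ => (le_div_iff₀' (by linarith)).2
      (S.integral_disagreement_le hN hβ hμ hν hΔsymm hΔ hγα hτ0 hτ)⟩
  have hD : ∀ i, 0 ≤ ∑ j, G.a i j := fun i => Finset.sum_nonneg fun j _ => G.nonneg i j
  obtain ⟨M, hM0, hM⟩ : ∃ M, 0 < M ∧ ∀ i (τ : ℝ), 0 ≤ τ → (τ : EReal) < horizon S.t →
      ∫ s in (0 : ℝ)..τ, S.input i s ^ 2 ≤ M := by
    -- The total degree makes the bound uniform over agents, and `1` makes it positive, as the lower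
    -- bound on the time between events divides by it.
    refine ⟨max 1 (2 * β ^ 2 * (∑ i, ∑ j, G.a i j) * ((1 + γ ^ 2) * |C|)),
      lt_max_of_lt_left one_pos, fun i τ hτ0 hτ => le_max_of_le_right ?_⟩
    refine (S.integral_input_sq_le hΔ hτ0 hτ i).trans ?_
    have h1 := Finset.single_le_sum (f := fun i => ∑ j, G.a i j) (fun k _ => hD k)
      (Finset.mem_univ i)
    have h2 := (hC τ hτ0 hτ).trans (le_abs_self C)
    have h3 := hD i
    have h4 := h3.trans h1
    calc 2 * β ^ 2 * (∑ j, G.a i j) * ((1 + γ ^ 2) * ∫ s in (0 : ℝ)..τ, S.disagreement s)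
        ≤ 2 * β ^ 2 * (∑ j, G.a i j) * ((1 + γ ^ 2) * |C|) := by gcongr
      _ ≤ 2 * β ^ 2 * (∑ i, ∑ j, G.a i j) * ((1 + γ ^ 2) * |C|) := by gcongr
  have htop : horizon S.t = ⊤ := S.horizon_eq_top hN hα.le hμ hν hM0 hM
  have hlt : ∀ τ : ℝ, (τ : EReal) < horizon S.t := fun τ => htop ▸ EReal.coe_lt_top τ
  refine ⟨htop, S.tendsto_sub_of_connected hG fun i j hij => ?_,
    S.finite_instants_of_horizon_eq_top htop⟩
  refine S.tendsto_sub_of_edge htop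
    (C := max M (2 * ((1 + γ ^ 2) * C + 2 * G.lambdaMax hN * N * (μ / ν)) / G.a i j))
    (fun i τ hτ0 => le_max_of_le_left (hM i τ hτ0 (hlt τ))) fun τ hτ0 => le_max_of_le_right ?_
  rw [le_div_iff₀' hij]
  refine (S.integral_sq_sub_le hN hμ hν hγα hτ0 (hlt τ) i j).trans ?_
  have := hC τ hτ0 (hlt τ)
  gcongr
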